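/- Let $E$ be a real inner product space of dimension $d\ge 1$ (that is, $\mathbb R^d$ with an arbitrary inner product $\langle\cdot,\cdot\rangle$ and its norm), and let $\mathcal A\subset E$ be a finite set of $N$ actions such that the unit ball of $E$ is John's ellipsoid of $\mathrm{Conv}(\mathcal A)$, i.e. an ellipsoid of minimal volume among the ellipsoids enclosing $\mathrm{Conv}(\mathcal A)$ (in particular $\mathcal A$ has full rank). Call a probability distribution $\mu$ on $\mathcal A$ a John exploration distribution if $\mu(u)\neq 0$ only for $u$ on the unit sphere and $$x=d\sum_{u\in\mathcal A}\mu(u)\langle x,u\rangle u\qquad\text{for all }x\in E.$$ Then there is a John exploration distribution, charging at most $d(d+1)/2+1$ points; and for every John exploration distribution $\mu$ the following holds. Let $\mathcal Z\subset E$ satisfy $|\langle a,z\rangle|\le 1$ for all $a\in\mathcal A$, $z\in\mathcal Z$. With parameters $\eta,\gamma$ and exploration $\mu$, the strategy exp2 starts from the uniform weights $q_1=1/N$ on $\mathcal A$ and, in each round $t=1,\dots,n$ ($n\ge 1$), plays a random action $a_t$ drawn from $p_t=(1-\gamma)q_t+\gamma\mu$, while the adversary simultaneously chooses $z_t\in\mathcal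 Z$ (the choice may be randomized and may depend on the past, but given the past and $z_t$ the action $a_t$ has law $p_t$). It then updates, for $a\in\mathcal A$, $$q_{t+1}(a)=\frac{e^{-\eta\langle a,\tilde z_t\rangle}q_t(a)}{\sum_{b\in\mathcal A}e^{-\eta\langle b,\tilde z_t\rangle}q_t(b)},\qquad \tilde z_t=P_t^{-1}(a_t\otimes a_t)z_t,\qquad P_t=\sum_{a\in\mathcal A}p_t(a)\,a\otimes a,$$ where $(u\otimes u)x=\langle u,x\rangle u$. Let $$R_n=\mathbb E\sum_{t=1}^n\langle a_t,z_t\rangle-\min_{a\in\mathcal A}\mathbb E\sum_{t=1}^n\langle a,z_t\rangle .$$ For all parameters for which the strategy can be so played (each $p_t$ is a probability distribution, as is always the case for $0\le\gamma\le 1$): 1. if $\eta>0$, $\gamma>0$ and $\frac{\eta d}{\gamma}\le 1$, then $R_n\le 2\gamma n+\frac{\log N}{\eta}+\eta n d$; 2. if $\gamma=\eta d$ and $\eta=\sqrt{\frac{\log N}{3nd}}$, then $R_n\le 2\sqrt{3nd\log N}$. -/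

import Mathlib

open MeasureTheory
open scoped RealInnerProductSpace

noncomputable section

/-! ### Minimal enclosing ellipsoids and the exploration distribution -/

section Geometry

variable {E : Type*} [NormedAddCommGroup E] [InnerProductSpace ℝ E]

/-- `S` is a (non-degenerate) ellipsoid: `S = {x | ⟪x - c, T (x - c)⟫ ≤ 1}` for a centre `c` and a
symmetric positive definite `T`. -/
def IsEllipsoid (S : Set E) : Prop :=
  ∃ (c : E) (T : E →ₗ[ℝ] E), T.IsSymmetric ∧ (∀ x, x ≠ 0 → 0 < ⟪x, T x⟫) ∧
    S = {x | ⟪x - c, T (x - c)⟫ ≤ 1}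

/-- `S` is John's ellipsoid of `K`: an ellipsoid of minimal volume enclosing `K`. -/
structure IsJohnEllipsoid [FiniteDimensional ℝ E] [MeasurableSpace E] [BorelSpace E]
    (K S : Set E) : Prop where
  isEllipsoid : IsEllipsoid S
  subset : K ⊆ S
  minimal : ∀ S' : Set E, IsEllipsoid S' → K ⊆ S' → volume S ≤ volume S'

/-- `ν` is a John exploration distribution for the action set `A`, when John's ellipsoid of the
convex hull of `A` is the unit ball: a probability distribution on `A` that charges only points
of contact with the unit ball, such that `x = d ∑ u, ν u ⟪x, u⟫ u` for all `x`. -/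
structure IsJohnExploration (A : Finset E) (ν : E → ℝ) : Prop where
  nonneg : ∀ u ∈ A, 0 ≤ ν u
  sum_eq_one : ∑ u ∈ A, ν u = 1
  contact : ∀ u ∈ A, ν u ≠ 0 → u ∈ Metric.sphere (0 : E) 1
  decomposition : ∀ x : E, x = (Module.finrank ℝ E : ℝ) • ∑ u ∈ A, (ν u * ⟪x, u⟫) • u

end Geometry

/-! ### The strategy, along a fixed sequence of actions `a` and loss vectors `z`

Rounds are numbered from `0`. -/

section Strategy

variable {E : Type*} [NormedAddCommGroup E] [InnerProductSpace ℝ E]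

/-- The outer product `u ⊗ u`, that is `x ↦ ⟪u, x⟫ u`. -/
def outerSelf (u : E) : E →L[ℝ] E := InnerProductSpace.rankOne ℝ u u

/-- The mixture `(1 - γ) q + γ ν`. -/
def mixture (γ : ℝ) (ν q : E → ℝ) (x : E) : ℝ := (1 - γ) * q x + γ * ν x

/-- `∑ x ∈ A, p x (x ⊗ x)`. -/
def secondMoment (A : Finset E) (p : E → ℝ) : E →L[ℝ] E := ∑ x ∈ A, p x • outerSelf x

/-- The loss estimate `P⁻¹ (a ⊗ a) z`, where `P = ∑ x ∈ A, p x (x ⊗ x)`. -/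
def lossEstimate (A : Finset E) (p : E → ℝ) (a z : E) : E :=
  Ring.inverse (secondMoment A p) (outerSelf a z)

/-- The exponential weights: `q` is uniform in the first round, and the weight of `x` is then
multiplied by `exp (-η ⟪x, z̃⟫)` and normalized over `A`, where `z̃` is the loss estimate of the
round, computed with the played distribution `(1 - γ) q + γ ν`. -/
def expWeights (A : Finset E) (ν : E → ℝ) (η γ : ℝ) (a z : ℕ → E) : ℕ → E → ℝ
  | 0 => fun _ => 1 / (A.card : ℝ)
  | t + 1 => fun x =>
      Real.exp (-η * ⟪x, lossEstimate A (mixture γ ν (expWeights A ν η γ a z t)) (a t) (z t)⟫)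
          * expWeights A ν η γ a z t x /
        ∑ b ∈ A,
          Real.exp (-η * ⟪b, lossEstimate A (mixture γ ν (expWeights A ν η γ a z t)) (a t) (z t)⟫)
            * expWeights A ν η γ a z t b

/-- The distribution `p = (1 - γ) q + γ ν` from which the action of round `t` is drawn. It depends
only on the actions and the incurred losses of the rounds before `t`. -/
def playDist (A : Finset E) (ν : E → ℝ) (η γ : ℝ) (a z : ℕ → E) (t : ℕ) : E → ℝ :=
  mixture γ ν (expWeights A ν η γ a z t)

end Strategy

/-! ### The game -/

section Game

variable {E : Type*} [NormedAddCommGroup E] [InnerProductSpace ℝ E] [MeasurableSpace E]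
variable {Ω : Type*}

/-- The information fixed when the action of round `t` is drawn: the actions of the earlier rounds
and the loss vectors up to and including the one of round `t`. -/
@[reducible]
def history (a z : ℕ → Ω → E) (t : ℕ) : MeasurableSpace Ω :=
  (⨆ s < t, MeasurableSpace.comap (a s) inferInstance) ⊔
    (⨆ s ≤ t, MeasurableSpace.comap (z s) inferInstance)

/-- The random actions `a` and loss vectors `z` are `n` rounds of play of the strategy against an
adversary with moves in `Z`. The adversary is arbitrary (it may be randomized, and may react to
the past of the game), except that it moves simultaneously with the player: given the past and the
loss vector of round `t`, the action of round `t` has law `playDist`. -/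
structure IsExp2Play [MeasurableSpace Ω] (P : Measure Ω) (A : Finset E) (Z : Set E) (ν : E → ℝ)
    (η γ : ℝ) (n : ℕ) (a z : ℕ → Ω → E) : Prop where
  measurable_action : ∀ t < n, Measurable (a t)
  measurable_loss : ∀ t < n, Measurable (z t)
  action_mem : ∀ t < n, ∀ ω, a t ω ∈ A
  loss_mem : ∀ t < n, ∀ ω, z t ω ∈ Z
  action_law : ∀ t < n, ∀ x ∈ A,
    P[(a t ⁻¹' {x}).indicator (fun _ => (1 : ℝ)) | history a z t] =ᵐ[P]
      fun ω => playDist A ν η γ (fun s => a s ω) (fun s => z s ω) t x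

/-- The regret `E ∑ₜ ⟪aₜ, zₜ⟫ - min_{x ∈ A} E ∑ₜ ⟪x, zₜ⟫` after `n` rounds. -/
def regret [MeasurableSpace Ω] (P : Measure Ω) (A : Finset E) (n : ℕ) (a z : ℕ → Ω → E) : ℝ :=
  (∫ ω, ∑ t ∈ Finset.range n, ⟪a t ω, z t ω⟫ ∂P) -
    ⨅ x : A, ∫ ω, ∑ t ∈ Finset.range n, ⟪(x : E), z t ω⟫ ∂P

end Game

end

/-! ### John's decomposition of the identity and its support size. -/

section John

variable {E : Type*} [NormedAddCommGroup E] [InnerProductSpace ℝ E]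

/-! Existence of the exploration is a variational argument. If a symmetric `H` of positive trace
satisfied `⟪u, H u⟫ < 0` at every contact point, then for small `ε > 0` the preimage of the ball
under `1 + ε H` would still enclose the actions and have smaller volume. By Hahn-Banach, the absence
of such an `H` puts `d⁻¹ • 1` in the convex hull of the `u ⊗ u` over contact points
(`IsJohnEllipsoid.one_mem_convexHull`). Carathéodory's theorem, in the symmetric operators, bounds
the support.

For the regret, John's identity gives `P_t ≥ (γ / d) • 1`, so estimated losses are at most `d / γ`
in absolute value, and `η d / γ ≤ 1` is what the second-order bound for exponential weights needs.
Averaged over the action, the estimates are unbiased and their second moment is at most `tr (P_t⁻¹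
P_t) = d`; exploring costs at most `2 γ` per round. `sum_mixture_mul_estimationGap_le` collects this
for one round, and `integral_apply_eq_of_condExp` carries it to expectations against an adaptive
adversary. -/

theorem outerSelf_apply (u x : E) : outerSelf u x = ⟪u, x⟫ • u := rfl

/-- A linear functional on operators is represented, on the operators `u ⊗ u` and on the identity,
by a symmetric operator. -/
theorem exists_isSymmetric_of_functional [FiniteDimensional ℝ E] (f : (E →L[ℝ] E) →ₗ[ℝ] ℝ) :
    ∃ H : E →ₗ[ℝ] E, H.IsSymmetric ∧ (∀ x, ⟪x, H x⟫ = f (outerSelf x)) ∧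
      LinearMap.trace ℝ E H = f 1 := by
  let b := stdOrthonormalBasis ℝ E
  -- Symmetrizing makes `H` symmetric without changing the values `f (u ⊗ u)`.
  let B : E → E → ℝ := fun x y =>
    (f (InnerProductSpace.rankOne ℝ x y) + f (InnerProductSpace.rankOne ℝ y x)) / 2
  have hadd : ∀ x x' y, B (x + x') y = B x y + B x' y := by
    intro x x' y; simp only [B, map_add, add_apply]; ring
  have hsmul : ∀ (c : ℝ) x y, B (c • x) y = c * B x y := by
    intro c x y
    simp only [B, map_smul, smul_apply, smul_eq_mul]; ring
  have hsymm : ∀ x y, B x y = B y x := fun x y => by simp only [B]; ring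
  let H : E →ₗ[ℝ] E :=
    { toFun := fun x => ∑ i, B x (b i) • b i
      map_add' := fun x y => by simp only [hadd, add_smul, Finset.sum_add_distrib]
      map_smul' := fun c x => by simp only [hsmul, mul_smul, Finset.smul_sum, RingHom.id_apply] }
  let By : E → E →ₗ[ℝ] ℝ := fun x =>
    { toFun := fun y => B y x
      map_add' := fun y z => hadd y z x
      map_smul' := fun c y => by simp [hsmul] }
  have hH : ∀ x y, ⟪y, H x⟫ = B x y := by
    intro x y
    have h1 : By x y = By x (∑ i, ⟪b i, y⟫ • b i) := by rw [b.sum_repr' y]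
    have h2 : B x y = By x y := hsymm x y
    rw [h2, h1, map_sum]
    change ⟪y, ∑ i, B x (b i) • b i⟫ = _
    rw [inner_sum]
    refine Finset.sum_congr rfl fun i _ => ?_
    rw [map_smul, inner_smul_right, real_inner_comm, smul_eq_mul, mul_comm]
    congr 1
    exact hsymm _ _
  have hdiag : ∀ x, ⟪x, H x⟫ = f (outerSelf x) := by
    intro x; rw [hH]; simp only [B, outerSelf]; ring
  refine ⟨H, ?_, hdiag, ?_⟩
  · intro x y
    rw [hH, real_inner_comm, hH, hsymm]
  · rw [LinearMap.trace_eq_sum_inner H b]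
    simp only [hdiag, ← map_sum]
    congr 1
    ext x
    simp only [sum_apply, outerSelf_apply]
    exact b.sum_repr' x

/-- The determinant expands as `1 + ε (tr H + O(ε))`; the polynomial `q` in the proof carries the
remainder. -/
theorem eventually_one_lt_det [FiniteDimensional ℝ E] (H : E →ₗ[ℝ] E)
    (hH : 0 < LinearMap.trace ℝ E H) :
    ∀ᶠ ε in nhdsWithin (0 : ℝ) (Set.Ioi 0), 1 < LinearMap.det (1 + ε • H) := by
  let b := (stdOrthonormalBasis ℝ E).toBasis
  have hdet : ∀ ε : ℝ, LinearMap.det (1 + ε • H) =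
      (1 + ε • LinearMap.toMatrix b b H).det := by
    intro ε
    rw [← LinearMap.det_toMatrix b, map_add, map_smul, LinearMap.toMatrix_one]
  rw [LinearMap.trace_eq_matrix_trace ℝ b] at hH
  set M := LinearMap.toMatrix b b H
  set q := (Matrix.det (1 + (Polynomial.X : Polynomial ℝ) • M.map Polynomial.C)).divX.divX
  have hc : Continuous fun ε : ℝ => M.trace + q.eval ε * ε := by fun_prop
  have h0 : ∀ᶠ ε in nhds (0 : ℝ), 0 < M.trace + q.eval ε * ε :=
    hc.continuousAt.eventually_const_lt (by simpa using hH)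
  filter_upwards [nhdsWithin_le_nhds h0, self_mem_nhdsWithin] with ε h1 h2
  have h2 : 0 < ε := h2
  rw [hdet, Matrix.det_one_add_smul]
  have := mul_pos h1 h2
  nlinarith

theorem eventually_norm_add_smul_le_one {x y : E} (hx : ‖x‖ ≤ 1) (hxy : ‖x‖ = 1 → ⟪x, y⟫ < 0) :
    ∀ᶠ ε in nhdsWithin (0 : ℝ) (Set.Ioi 0), ‖x + ε • y‖ ≤ 1 := by
  rcases hx.lt_or_eq with hlt | heq
  · have hc : Continuous fun ε : ℝ => ‖x + ε • y‖ := by fun_prop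
    have h0 : ∀ᶠ ε in nhds (0 : ℝ), ‖x + ε • y‖ < 1 :=
      hc.continuousAt.eventually_lt_const (by simpa using hlt)
    exact nhdsWithin_le_nhds (h0.mono fun _ h => h.le)
  · have hc : Continuous fun ε : ℝ => 2 * ⟪x, y⟫ + ε * ‖y‖ ^ 2 := by fun_prop
    have h0 : ∀ᶠ ε in nhds (0 : ℝ), 2 * ⟪x, y⟫ + ε * ‖y‖ ^ 2 < 0 :=
      hc.continuousAt.eventually_lt_const (by have := hxy heq; simp only [zero_mul, add_zero]; linarith)
    filter_upwards [nhdsWithin_le_nhds h0, self_mem_nhdsWithin] with ε h1 h2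
    have h2 : 0 < ε := h2
    have h3 : ‖x + ε • y‖ ^ 2 = 1 + ε * (2 * ⟪x, y⟫ + ε * ‖y‖ ^ 2) := by
      rw [norm_add_sq_real, heq, inner_smul_right, norm_smul, Real.norm_eq_abs, abs_of_pos h2]
      ring
    have h4 : ‖x + ε • y‖ ^ 2 ≤ 1 := by nlinarith [mul_neg_of_pos_of_neg h2 h1]
    exact (sq_le_one_iff₀ (norm_nonneg _)).1 h4

/-- If the unit ball is a minimal ellipsoid around `A`, no symmetric operator of positive trace is
negative on all contact points. -/
theorem IsJohnEllipsoid.exists_contact_nonneg [FiniteDimensional ℝ E] [MeasurableSpace E]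
    [BorelSpace E] {A : Finset E}
    (hA : IsJohnEllipsoid (convexHull ℝ (A : Set E)) (Metric.closedBall (0 : E) 1))
    {H : E →ₗ[ℝ] E} (hs : H.IsSymmetric) (htr : 0 < LinearMap.trace ℝ E H) :
    ∃ u ∈ A, ‖u‖ = 1 ∧ 0 ≤ ⟪u, H u⟫ := by
  by_contra! hcon
  have hball : ∀ u ∈ A, ‖u‖ ≤ 1 := fun u hu => by
    simpa using hA.subset (subset_convexHull ℝ _ hu)
  have hev : ∀ᶠ ε in nhdsWithin (0 : ℝ) (Set.Ioi 0),
      1 < LinearMap.det (1 + ε • H) ∧ ∀ u ∈ A, ‖u + ε • H u‖ ≤ 1 := by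
    refine (eventually_one_lt_det H htr).and ((Filter.eventually_all_finset A).2 fun u hu => ?_)
    exact eventually_norm_add_smul_le_one (hball u hu) (hcon u hu)
  obtain ⟨ε, hdet, hin⟩ := hev.exists
  set L : E →ₗ[ℝ] E := 1 + ε • H with hL
  have hLs : L.IsSymmetric := by
    intro x y
    simp only [hL, LinearMap.add_apply, Module.End.one_apply, LinearMap.smul_apply, inner_add_left,
      inner_add_right, inner_smul_right, real_inner_smul_left, hs x y]
  have hLL : ∀ x, ⟪x, (L ∘ₗ L) x⟫ = ‖L x‖ ^ 2 := by
    intro x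
    rw [LinearMap.comp_apply, ← hLs, real_inner_self_eq_norm_sq]
  have hinj : ∀ x, L x = 0 → x = 0 := by
    have hu : IsUnit (LinearMap.det L) := isUnit_iff_ne_zero.2 (by linarith)
    intro x hx
    have hb := (Module.End.isUnit_iff L).1 ((LinearMap.isUnit_iff_isUnit_det L).2 hu)
    exact hb.1 (by simpa using hx)
  -- The competing ellipsoid: its form is `L²`, and its volume is that of the ball divided by `det L
  -- > 1`.
  have hS : L ⁻¹' Metric.closedBall 0 1 = {x | ⟪x - 0, (L ∘ₗ L) (x - 0)⟫ ≤ 1} := by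
    ext x
    simp only [Set.mem_preimage, mem_closedBall_zero_iff, sub_zero, Set.mem_ofPred_eq, hLL]
    exact (sq_le_one_iff₀ (norm_nonneg _)).symm
  have hell : IsEllipsoid (L ⁻¹' Metric.closedBall 0 1) := by
    refine ⟨0, L ∘ₗ L, ?_, fun x hx => ?_, hS⟩
    · intro x y
      simp only [LinearMap.comp_apply]
      rw [hLs, hLs]
    · rw [hLL]
      have : L x ≠ 0 := fun h => hx (hinj x h)
      positivity
  have hsub : convexHull ℝ (A : Set E) ⊆ L ⁻¹' Metric.closedBall 0 1 := by
    refine convexHull_min (fun u hu => ?_) ((convex_closedBall 0 1).linear_preimage L)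
    simpa [hL] using hin u hu
  have hmin := hA.minimal _ hell hsub
  rw [Measure.addHaar_preimage_linearMap volume (by linarith)] at hmin
  have hpos : volume (Metric.closedBall (0 : E) 1) ≠ 0 :=
    (Metric.measure_closedBall_pos volume 0 one_pos).ne'
  have hfin : volume (Metric.closedBall (0 : E) 1) ≠ ⊤ := measure_closedBall_lt_top.ne
  have hlt : ENNReal.ofReal |(LinearMap.det L)⁻¹| < 1 := by
    rw [ENNReal.ofReal_lt_one, abs_of_pos (inv_pos.2 (by linarith))]
    exact inv_lt_one_of_one_lt₀ hdet
  have := ENNReal.mul_lt_mul_left hpos hfin hlt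
  rw [one_mul] at this
  exact absurd hmin (not_le.2 this)

theorem IsJohnEllipsoid.one_mem_convexHull [FiniteDimensional ℝ E] [MeasurableSpace E]
    [BorelSpace E] [Nontrivial E] {A : Finset E}
    (hA : IsJohnEllipsoid (convexHull ℝ (A : Set E)) (Metric.closedBall (0 : E) 1)) :
    ((Module.finrank ℝ E : ℝ)⁻¹ • (1 : E →L[ℝ] E)) ∈
      convexHull ℝ (outerSelf '' {u : E | u ∈ A ∧ ‖u‖ = 1}) := by
  by_contra hcon
  have hd : (0 : ℝ) < Module.finrank ℝ E := by exact_mod_cast Module.finrank_pos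
  have hfin : (outerSelf '' {u : E | u ∈ A ∧ ‖u‖ = 1}).Finite :=
    (A.finite_toSet.subset fun u hu => hu.1).image _
  obtain ⟨f, s, hf1, hf2⟩ := geometric_hahn_banach_closed_point (convex_convexHull ℝ _)
    (hfin.isCompact_convexHull ℝ).isClosed hcon
  obtain ⟨H, hs, hdiag, htr⟩ := exists_isSymmetric_of_functional f.toLinearMap
  -- Shifting by the separating level `s` makes the form negative at contact points, while the trace
  -- `f 1 - s d` is positive.
  have hs' : (H - s • (1 : E →ₗ[ℝ] E)).IsSymmetric := by
    intro x y
    simp only [LinearMap.sub_apply, Module.End.one_apply, LinearMap.smul_apply, inner_sub_left,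
      inner_sub_right, inner_smul_right, real_inner_smul_left, hs x y]
  have htr' : 0 < LinearMap.trace ℝ E (H - s • (1 : E →ₗ[ℝ] E)) := by
    rw [map_sub, map_smul, htr, LinearMap.trace_one, smul_eq_mul]
    rw [map_smul, smul_eq_mul, lt_inv_mul_iff₀ hd] at hf2
    change 0 < f 1 - _
    linarith
  obtain ⟨u, huA, hu1, hu⟩ := hA.exists_contact_nonneg hs' htr'
  have h1 := hf1 _ (subset_convexHull ℝ _ ⟨u, ⟨huA, hu1⟩, rfl⟩)
  simp only [LinearMap.sub_apply, Module.End.one_apply, LinearMap.smul_apply, inner_sub_right,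
      inner_smul_right, hdiag, real_inner_self_eq_norm_sq, hu1] at hu
  change 0 ≤ f (outerSelf u) - _ at hu
  linarith

/-- These operators are symmetric, hence determined by matrix entries indexed by unordered pairs
from `Fin d`, of which there are `d (d + 1) / 2`. -/
theorem finrank_span_outerSelf_le [FiniteDimensional ℝ E] :
    Module.finrank ℝ (Submodule.span ℝ (Set.range (outerSelf : E → E →L[ℝ] E))) ≤
      Module.finrank ℝ E * (Module.finrank ℝ E + 1) / 2 := by
  set d := Module.finrank ℝ E
  let b := stdOrthonormalBasis ℝ E
  set S := Submodule.span ℝ (Set.range (outerSelf : E → E →L[ℝ] E)) with hS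
  have hsymm : ∀ T ∈ S, ∀ x y, ⟪x, T y⟫ = ⟪y, T x⟫ := by
    intro T hT
    induction hT using Submodule.span_induction with
    | mem T hT =>
      obtain ⟨u, rfl⟩ := hT
      intro x y
      simp only [outerSelf_apply, inner_smul_right, real_inner_comm x u, real_inner_comm y u]
      ring
    | zero => simp
    | add T T' _ _ h h' => intro x y; simp only [add_apply, inner_add_right, h x y, h' x y]
    | smul c T _ h => intro x y; simp only [smul_apply, inner_smul_right, h x y]
  let φ : S →ₗ[ℝ] (Sym2 (Fin d) → ℝ) :=
    { toFun := fun T p => Sym2.lift ⟨fun i j => ⟪b i, (T : E →L[ℝ] E) (b j)⟫,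
        fun i j => hsymm T T.2 _ _⟩ p
      map_add' := fun T T' => by
        ext p
        induction p using Sym2.ind with
        | _ i j => simp [inner_add_right]
      map_smul' := fun c T => by
        ext p
        induction p using Sym2.ind with
        | _ i j => simp [inner_smul_right] }
  have hφ : Function.Injective φ := by
    rw [← LinearMap.ker_eq_bot, LinearMap.ker_eq_bot']
    intro T hT
    have hij : ∀ i j, ⟪b i, (T : E →L[ℝ] E) (b j)⟫ = 0 := fun i j => congrFun hT s(i, j)
    have : ((T : E →L[ℝ] E) : E →ₗ[ℝ] E) = 0 := by
      refine b.toBasis.ext fun j => ?_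
      simp only [OrthonormalBasis.coe_toBasis, ContinuousLinearMap.coe_coe, LinearMap.zero_apply]
      rw [← b.sum_repr' ((T : E →L[ℝ] E) (b j))]
      simp [hij]
    ext x
    exact congrArg (fun g : E →ₗ[ℝ] E => g x) this
  have := LinearMap.finrank_le_finrank_of_injective hφ
  rw [Module.finrank_fintype_fun_eq_card, Sym2.card, Fintype.card_fin, Nat.choose_two_right,
    Nat.add_sub_cancel, mul_comm] at this
  exact this

/-- Pushes weights on indices forward to weights on points; `u` need not be injective. -/
theorem sum_fiber_smul {α ι F : Type*} [DecidableEq α] [Fintype ι] [AddCommGroup F] [Module ℝ F]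
    {A : Finset α} {u : ι → α} (hu : ∀ i, u i ∈ A) (w : ι → ℝ) (g : α → F) :
    ∑ v ∈ A, (∑ i, if u i = v then w i else 0) • g v = ∑ i, w i • g (u i) := by
  simp only [Finset.sum_smul, ite_smul, zero_smul]
  rw [Finset.sum_comm]
  refine Finset.sum_congr rfl fun i _ => ?_
  rw [Finset.sum_ite_eq, if_pos (hu i)]

theorem IsJohnEllipsoid.exists_isJohnExploration [FiniteDimensional ℝ E] [MeasurableSpace E]
    [BorelSpace E] [Nontrivial E] {A : Finset E}
    (hA : IsJohnEllipsoid (convexHull ℝ (A : Set E)) (Metric.closedBall (0 : E) 1)) :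
    ∃ ν : E → ℝ, IsJohnExploration A ν ∧
      {u | u ∈ A ∧ ν u ≠ 0}.ncard ≤ Module.finrank ℝ E * (Module.finrank ℝ E + 1) / 2 + 1 := by
  classical
  obtain ⟨ι, _, y, w, hy, hind, hw, hw1, hsum⟩ :=
    eq_pos_convex_span_of_mem_convexHull hA.one_mem_convexHull
  choose u hu huy using fun i => hy (Set.mem_range_self i)
  have hcard : Fintype.card ι ≤ Module.finrank ℝ E * (Module.finrank ℝ E + 1) / 2 + 1 := by
    -- Affine independence allows one point more than the dimension of the direction space, whence
    -- the `+ 1`.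
    refine hind.card_le_finrank_succ.trans (Nat.succ_le_succ (le_trans ?_
      (finrank_span_outerSelf_le (E := E))))
    refine Submodule.finrank_mono ?_
    rw [vectorSpan_def, Submodule.span_le]
    rintro _ ⟨_, ⟨i, rfl⟩, _, ⟨j, rfl⟩, rfl⟩
    simp only [← huy]
    exact Submodule.sub_mem _ (Submodule.subset_span ⟨_, rfl⟩) (Submodule.subset_span ⟨_, rfl⟩)
  have hmem : ∀ i, u i ∈ A := fun i => (hu i).1
  refine ⟨fun v => ∑ i, if u i = v then w i else 0, ⟨?_, ?_, ?_, ?_⟩, ?_⟩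
  · exact fun v _ => Finset.sum_nonneg fun i _ => by split_ifs <;> simp [(hw i).le]
  · simpa [hw1] using sum_fiber_smul hmem w fun _ => (1 : ℝ)
  · intro v _ hv
    obtain ⟨i, _, hi⟩ := Finset.exists_ne_zero_of_sum_ne_zero hv
    have : u i = v := by by_contra h; simp [h] at hi
    simpa [← this] using (hu i).2
  · intro x
    have hd : (Module.finrank ℝ E : ℝ) ≠ 0 := by exact_mod_cast Module.finrank_pos.ne'
    have h1 := congrArg (fun T : E →L[ℝ] E => T x) hsum
    simp only [sum_apply, smul_apply, ← huy, outerSelf_apply] at h1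
    have h2 := sum_fiber_smul hmem w fun v => ⟪x, v⟫ • v
    simp only [smul_smul] at h2 h1
    rw [h2]
    simp only [real_inner_comm x] at h1 ⊢
    rw [h1, smul_smul, mul_inv_cancel₀ hd, one_smul]
    rfl
  · refine le_trans ?_ hcard
    have hsub : {v | v ∈ A ∧ (∑ i, if u i = v then w i else 0) ≠ 0} ⊆
        ((Finset.univ.image u : Finset E) : Set E) := by
      rintro v ⟨_, hv⟩
      obtain ⟨i, _, hi⟩ := Finset.exists_ne_zero_of_sum_ne_zero hv
      have : u i = v := by by_contra h; simp [h] at hi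
      simp [← this]
    refine (Set.ncard_le_ncard hsub (Finset.finite_toSet _)).trans ?_
    rw [Set.ncard_coe_finset]
    exact Finset.card_image_le

end John

/-! ### Exponential weights and the loss estimates of one round. -/

section Exp2

variable {E : Type*} [NormedAddCommGroup E] [InnerProductSpace ℝ E]

/-- Exponential weights against losses `l`: the regret inequality with a second-order term. -/
theorem exp_weights_regret_le {α : Type*} {A : Finset α} {η : ℝ} (hη : 0 < η) {q l : ℕ → α → ℝ}
    {n : ℕ} (hpos : ∀ t, ∀ x ∈ A, 0 < q t x) (hsum : ∀ t, ∑ x ∈ A, q t x = 1)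
    (hzero : ∀ x ∈ A, q 0 x = 1 / (A.card : ℝ))
    (hsucc : ∀ t < n, ∀ x ∈ A, q (t + 1) x =
      Real.exp (-η * l t x) * q t x / ∑ b ∈ A, Real.exp (-η * l t b) * q t b)
    (hl : ∀ t < n, ∀ x ∈ A, η * |l t x| ≤ 1) {x : α} (hx : x ∈ A) :
    ∑ t ∈ Finset.range n,
        (∑ b ∈ A, q t b * l t b - l t x - η * ∑ b ∈ A, q t b * l t b ^ 2) ≤
      Real.log A.card / η := by
  -- The potential is `log (q m x)`: it starts at `-log N` and never exceeds `0`.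
  have hind : ∀ m ≤ n, -Real.log A.card + η * ∑ t ∈ Finset.range m,
      (∑ b ∈ A, q t b * l t b - l t x - η * ∑ b ∈ A, q t b * l t b ^ 2) ≤ Real.log (q m x) := by
    intro m
    induction m with
    | zero => simp [hzero x hx]
    | succ t ih =>
      intro ht
      have iht := ih (by omega)
      rw [Finset.sum_range_succ, hsucc t (by omega) x hx]
      set W := ∑ b ∈ A, Real.exp (-η * l t b) * q t b with hW
      have hWpos : 0 < W := Finset.sum_pos
        (fun b hb => mul_pos (Real.exp_pos _) (hpos t b hb)) ⟨x, hx⟩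
      have hqx := hpos t x hx
      rw [Real.log_div (mul_pos (Real.exp_pos _) hqx).ne' hWpos.ne',
        Real.log_mul (Real.exp_pos _).ne' hqx.ne', Real.log_exp]
      -- From `exp u ≤ 1 + u + u ^ 2` for `|u| ≤ 1`.
      have hWle : W ≤ 1 - η * ∑ b ∈ A, q t b * l t b + η ^ 2 * ∑ b ∈ A, q t b * l t b ^ 2 := by
        have h1 : W ≤ ∑ b ∈ A, (q t b - η * (q t b * l t b) + η ^ 2 * (q t b * l t b ^ 2)) := by
          refine Finset.sum_le_sum fun b hb => ?_
          have habs : |(-η * l t b)| ≤ 1 := by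
            rw [abs_mul, abs_neg, abs_of_pos hη]
            exact hl t (by omega) b hb
          have h2 := (abs_le.1 (Real.abs_exp_sub_one_sub_id_le habs)).2
          have h3 := mul_le_mul_of_nonneg_right h2 (hpos t b hb).le
          linarith
        rwa [Finset.sum_add_distrib, Finset.sum_sub_distrib, hsum, ← Finset.mul_sum,
          ← Finset.mul_sum] at h1
      have hlog := Real.log_le_sub_one_of_pos hWpos
      linarith
  have hq1 : q n x ≤ 1 := by
    rw [← hsum n]
    exact Finset.single_le_sum (fun b hb => (hpos n b hb).le) hx
  have h := (hind n le_rfl).trans (Real.log_nonpos (hpos n x hx).le hq1)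
  rw [le_div_iff₀ hη]
  linarith

theorem expWeights_pos_and_sum {A : Finset E} (hA : A.Nonempty) (ν : E → ℝ) (η γ : ℝ)
    (a z : ℕ → E) (t : ℕ) :
    (∀ x ∈ A, 0 < expWeights A ν η γ a z t x) ∧ ∑ x ∈ A, expWeights A ν η γ a z t x = 1 := by
  induction t with
  | zero =>
    have hc : (0 : ℝ) < A.card := by exact_mod_cast hA.card_pos
    refine ⟨fun x _ => ?_, ?_⟩
    · simp only [expWeights]; positivity
    · simp only [expWeights, Finset.sum_const, nsmul_eq_mul]; field_simp
  | succ t ih =>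
    have hpos : 0 < ∑ b ∈ A,
        Real.exp (-η * ⟪b, lossEstimate A (mixture γ ν (expWeights A ν η γ a z t)) (a t) (z t)⟫)
          * expWeights A ν η γ a z t b :=
      Finset.sum_pos (fun b hb => mul_pos (Real.exp_pos _) (ih.1 b hb)) hA
    refine ⟨fun x hx => ?_, ?_⟩
    · exact div_pos (mul_pos (Real.exp_pos _) (ih.1 x hx)) hpos
    · simp only [expWeights]
      rw [← Finset.sum_div, div_self hpos.ne']

theorem secondMoment_apply (A : Finset E) (p : E → ℝ) (x : E) :
    secondMoment A p x = ∑ u ∈ A, (p u * ⟪u, x⟫) • u := by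
  simp only [secondMoment, sum_apply, smul_apply, outerSelf_apply, smul_smul]

theorem inner_secondMoment (A : Finset E) (p : E → ℝ) (x : E) :
    ⟪x, secondMoment A p x⟫ = ∑ u ∈ A, p u * ⟪u, x⟫ ^ 2 := by
  rw [secondMoment_apply, inner_sum]
  refine Finset.sum_congr rfl fun u _ => ?_
  rw [inner_smul_right, real_inner_comm]
  ring

theorem IsJohnExploration.sum_mul_inner_sq {A : Finset E} {ν : E → ℝ}
    (hν : IsJohnExploration A ν) (x : E) :
    Module.finrank ℝ E * ∑ u ∈ A, ν u * ⟪u, x⟫ ^ 2 = ‖x‖ ^ 2 := by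
  conv_rhs => rw [← real_inner_self_eq_norm_sq]; arg 3; rw [hν.decomposition x]
  rw [inner_smul_right, inner_sum]
  congr 1
  refine Finset.sum_congr rfl fun u _ => ?_
  rw [inner_smul_right, real_inner_comm]
  ring

/-- The exploration part alone contributes exactly `γ / d * ‖x‖ ^ 2`; the `q` part only adds to it.
-/
theorem IsJohnExploration.coercive_secondMoment {A : Finset E} {ν : E → ℝ}
    (hν : IsJohnExploration A ν) (hd : 0 < Module.finrank ℝ E) {γ : ℝ} (hγ1 : γ ≤ 1)
    {q : E → ℝ} (hq : ∀ x ∈ A, 0 ≤ q x) (x : E) :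
    γ / Module.finrank ℝ E * ‖x‖ ^ 2 ≤ ⟪x, secondMoment A (mixture γ ν q) x⟫ := by
  have hd' : (0 : ℝ) < Module.finrank ℝ E := by exact_mod_cast hd
  rw [← hν.sum_mul_inner_sq x, inner_secondMoment, ← mul_assoc, div_mul_cancel₀ _ hd'.ne',
    Finset.mul_sum]
  refine Finset.sum_le_sum fun u hu => ?_
  have := mul_nonneg (mul_nonneg (sub_nonneg.2 hγ1) (hq u hu)) (sq_nonneg ⟪u, x⟫)
  simp only [mixture]
  linarith

theorem isUnit_of_coercive [FiniteDimensional ℝ E] {c : ℝ} (hc : 0 < c) {T : E →L[ℝ] E}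
    (hT : ∀ x, c * ‖x‖ ^ 2 ≤ ⟪x, T x⟫) : IsUnit T := by
  have hinj : Function.Injective T := by
    refine (injective_iff_map_eq_zero T).2 fun x hx => ?_
    have := hT x
    rw [hx, inner_zero_right] at this
    by_contra hne
    have : 0 < ‖x‖ := norm_pos_iff.2 hne
    have : 0 < c * ‖x‖ ^ 2 := by positivity
    linarith
  have hb : Function.Bijective T := ⟨hinj, LinearMap.injective_iff_surjective.1 hinj⟩
  exact ContinuousLinearMap.isUnit_iff_bijective.2 hb

theorem apply_inverse_apply {T : E →L[ℝ] E} (hT : IsUnit T) (x : E) :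
    T (Ring.inverse T x) = x :=
  congrArg (fun S : E →L[ℝ] E => S x) (Ring.mul_inverse_cancel T hT)

theorem inverse_apply_apply {T : E →L[ℝ] E} (hT : IsUnit T) (x : E) :
    Ring.inverse T (T x) = x :=
  congrArg (fun S : E →L[ℝ] E => S x) (Ring.inverse_mul_cancel T hT)

theorem norm_inverse_apply_le [FiniteDimensional ℝ E] {c : ℝ} (hc : 0 < c) {T : E →L[ℝ] E}
    (hT : ∀ x, c * ‖x‖ ^ 2 ≤ ⟪x, T x⟫) (x : E) : ‖Ring.inverse T x‖ ≤ ‖x‖ / c := by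
  have h1 := hT (Ring.inverse T x)
  rw [apply_inverse_apply (isUnit_of_coercive hc hT)] at h1
  have h2 := h1.trans (real_inner_le_norm _ _)
  rw [le_div_iff₀ hc]
  rcases (norm_nonneg (Ring.inverse T x)).eq_or_lt with h | h
  · rw [← h, zero_mul]; exact norm_nonneg x
  · refine le_of_mul_le_mul_left ?_ h
    linarith

theorem lossEstimate_eq (A : Finset E) (p : E → ℝ) (y z : E) :
    lossEstimate A p y z = ⟪y, z⟫ • Ring.inverse (secondMoment A p) y := by
  rw [lossEstimate, outerSelf_apply, map_smul]

/-- The loss estimate is unbiased. -/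
theorem sum_mul_inner_lossEstimate {A : Finset E} {p : E → ℝ} (hp : IsUnit (secondMoment A p))
    (x z : E) : ∑ y ∈ A, p y * ⟪x, lossEstimate A p y z⟫ = ⟪x, z⟫ := by
  conv_rhs => rw [← inverse_apply_apply hp z, secondMoment_apply, map_sum, inner_sum]
  refine Finset.sum_congr rfl fun y _ => ?_
  rw [lossEstimate_eq, map_smul, inner_smul_right, inner_smul_right, mul_assoc]

/-- This is the trace of `P⁻¹ P = 1`, computed in an orthonormal basis. -/
theorem sum_mul_inner_inverse_secondMoment [FiniteDimensional ℝ E] {A : Finset E} {p : E → ℝ}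
    (hp : IsUnit (secondMoment A p)) :
    ∑ y ∈ A, p y * ⟪y, Ring.inverse (secondMoment A p) y⟫ = Module.finrank ℝ E := by
  let b := stdOrthonormalBasis ℝ E
  have h : ∀ i, ∑ y ∈ A, p y *
      (⟪y, b i⟫ * ⟪b i, Ring.inverse (secondMoment A p) y⟫) = 1 := by
    intro i
    have h1 : ⟪b i, b i⟫ = 1 := by rw [real_inner_self_eq_norm_sq, b.norm_eq_one, one_pow]
    rw [← h1]
    conv_rhs =>
      arg 3; rw [← inverse_apply_apply hp (b i), secondMoment_apply, map_sum]
    rw [inner_sum]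
    refine Finset.sum_congr rfl fun y _ => ?_
    rw [map_smul, inner_smul_right, mul_assoc]
  have hexp : ∀ y ∈ A, p y * ⟪y, Ring.inverse (secondMoment A p) y⟫ =
      ∑ i, p y * (⟪y, b i⟫ * ⟪b i, Ring.inverse (secondMoment A p) y⟫) := fun y _ => by
    rw [← Finset.mul_sum, b.sum_inner_mul_inner]
  rw [Finset.sum_congr rfl hexp, Finset.sum_comm, Finset.sum_congr rfl fun i _ => h i]
  simp

/-- The estimate is `⟪y, z⟫ • w` with `w = P⁻¹ y`, and `⟪w, P w⟫ = ⟪y, w⟫`. -/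
theorem inner_lossEstimate_secondMoment_le {A : Finset E} {p : E → ℝ}
    (hp : IsUnit (secondMoment A p)) (hp0 : ∀ u ∈ A, 0 ≤ p u) {y z : E} (hyz : |⟪y, z⟫| ≤ 1) :
    ∑ u ∈ A, p u * ⟪u, lossEstimate A p y z⟫ ^ 2 ≤
      ⟪y, Ring.inverse (secondMoment A p) y⟫ := by
  set w := Ring.inverse (secondMoment A p) y with hw
  have h1 : ⟪y, w⟫ = ∑ u ∈ A, p u * ⟪u, w⟫ ^ 2 := by
    rw [← inner_secondMoment, hw, apply_inverse_apply hp, real_inner_comm]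
  rw [h1]
  refine Finset.sum_le_sum fun u hu => mul_le_mul_of_nonneg_left ?_ (hp0 u hu)
  rw [lossEstimate_eq, inner_smul_right, mul_pow]
  exact mul_le_of_le_one_left (sq_nonneg _) ((sq_le_one_iff_abs_le_one _).2 hyz)

theorem mixture_nonneg {A : Finset E} {ν q : E → ℝ} {γ : ℝ} (hν : IsJohnExploration A ν)
    (hγ0 : 0 ≤ γ) (hγ1 : γ ≤ 1) (hq : ∀ x ∈ A, 0 ≤ q x) {x : E} (hx : x ∈ A) :
    0 ≤ mixture γ ν q x :=
  add_nonneg (mul_nonneg (sub_nonneg.2 hγ1) (hq x hx)) (mul_nonneg hγ0 (hν.nonneg x hx))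

theorem abs_inner_lossEstimate_le [FiniteDimensional ℝ E] {A : Finset E} {ν q : E → ℝ} {γ : ℝ}
    (hν : IsJohnExploration A ν) (hd : 0 < Module.finrank ℝ E) (hball : ∀ u ∈ A, ‖u‖ ≤ 1)
    (hγ0 : 0 < γ) (hγ1 : γ ≤ 1) (hq : ∀ x ∈ A, 0 ≤ q x) {x y z : E} (hx : x ∈ A) (hy : y ∈ A)
    (hyz : |⟪y, z⟫| ≤ 1) :
    |⟪x, lossEstimate A (mixture γ ν q) y z⟫| ≤ Module.finrank ℝ E / γ := by
  have hd' : (0 : ℝ) < Module.finrank ℝ E := by exact_mod_cast hd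
  have h1 := norm_inverse_apply_le (div_pos hγ0 hd') (hν.coercive_secondMoment hd hγ1 hq) y
  have h2 : ‖y‖ / (γ / Module.finrank ℝ E) ≤ Module.finrank ℝ E / γ := by
    rw [div_div_eq_mul_div]
    gcongr
    exact mul_le_of_le_one_left hd'.le (hball y hy)
  rw [lossEstimate_eq, inner_smul_right, abs_mul]
  refine (mul_le_of_le_one_left (abs_nonneg _) hyz).trans ?_
  refine (abs_real_inner_le_norm _ _).trans ?_
  exact (mul_le_of_le_one_left (norm_nonneg _) (hball x hx)).trans (h1.trans h2)

/-- The instantaneous regret against `x` of the action `y`, minus `1 - γ` times the corresponding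
quantity of the exponential weights `q` on the estimated losses. -/
noncomputable def estimationGap (A : Finset E) (ν : E → ℝ) (η γ : ℝ) (x : E) (q : E → ℝ) (y z : E) : ℝ :=
  ⟪y, z⟫ - ⟪x, z⟫ - (1 - γ) *
    (∑ b ∈ A, q b * ⟪b, lossEstimate A (mixture γ ν q) y z⟫ -
      ⟪x, lossEstimate A (mixture γ ν q) y z⟫ -
      η * ∑ b ∈ A, q b * ⟪b, lossEstimate A (mixture γ ν q) y z⟫ ^ 2)

/-- By unbiasedness the linear terms reduce to `γ` times the regret of `ν` against `x`, at most `2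
γ`; the quadratic term gives `η d`. -/
theorem sum_mixture_mul_estimationGap_le [FiniteDimensional ℝ E] {A : Finset E} {ν q : E → ℝ}
    {η γ : ℝ} (hν : IsJohnExploration A ν) (hd : 0 < Module.finrank ℝ E) (hη : 0 ≤ η)
    (hγ0 : 0 < γ) (hγ1 : γ ≤ 1) (hq : ∀ x ∈ A, 0 ≤ q x) (hq1 : ∑ x ∈ A, q x = 1)
    {x z : E} (hx : x ∈ A) (hz : ∀ u ∈ A, |⟪u, z⟫| ≤ 1) :
    ∑ y ∈ A, mixture γ ν q y * estimationGap A ν η γ x q y z ≤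
      2 * γ + η * Module.finrank ℝ E := by
  have hd' : (0 : ℝ) < Module.finrank ℝ E := by exact_mod_cast hd
  have hunit := isUnit_of_coercive (div_pos hγ0 hd') (hν.coercive_secondMoment hd hγ1 hq)
  set p := mixture γ ν q with hp
  have hp0 : ∀ u ∈ A, 0 ≤ p u := fun u hu => mixture_nonneg hν hγ0.le hγ1 hq hu
  have hp1 : ∑ u ∈ A, p u = 1 := by
    simp only [hp, mixture, Finset.sum_add_distrib, ← Finset.mul_sum, hq1, hν.sum_eq_one]
    ring
  let e := fun y => lossEstimate A p y z
  have hlin : ∀ b, ∑ y ∈ A, p y * ⟪b, e y⟫ = ⟪b, z⟫ := fun b =>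
    sum_mul_inner_lossEstimate hunit b z
  have hlinq : ∑ y ∈ A, p y * ∑ b ∈ A, q b * ⟪b, e y⟫ = ∑ b ∈ A, q b * ⟪b, z⟫ := by
    simp only [Finset.mul_sum]
    rw [Finset.sum_comm]
    refine Finset.sum_congr rfl fun b _ => ?_
    rw [← hlin b, Finset.mul_sum]
    exact Finset.sum_congr rfl fun y _ => by ring
  -- Since `(1 - γ) q ≤ p`, the factor is absorbed without dividing by `1 - γ`.
  have hquad : (1 - γ) * ∑ y ∈ A, p y * ∑ b ∈ A, q b * ⟪b, e y⟫ ^ 2 ≤ Module.finrank ℝ E := by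
    rw [← sum_mul_inner_inverse_secondMoment hunit, Finset.mul_sum]
    refine Finset.sum_le_sum fun y hy => ?_
    rw [mul_left_comm]
    refine mul_le_mul_of_nonneg_left ?_ (hp0 y hy)
    refine le_trans ?_ (inner_lossEstimate_secondMoment_le hunit hp0 (hz y hy))
    rw [Finset.mul_sum]
    refine Finset.sum_le_sum fun b hb => ?_
    have := mul_nonneg (mul_nonneg hγ0.le (hν.nonneg b hb)) (sq_nonneg ⟪b, e y⟫)
    simp only [e, hp, mixture] at this ⊢
    linarith
  have hmix : ∑ y ∈ A, p y * ⟪y, z⟫ =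
      (1 - γ) * ∑ b ∈ A, q b * ⟪b, z⟫ + γ * ∑ b ∈ A, ν b * ⟪b, z⟫ := by
    simp only [Finset.mul_sum, ← Finset.sum_add_distrib]
    exact Finset.sum_congr rfl fun y _ => by simp only [hp, mixture]; ring
  have hνz : ∑ b ∈ A, ν b * ⟪b, z⟫ ≤ 1 := by
    rw [← hν.sum_eq_one]
    exact Finset.sum_le_sum fun b hb =>
      mul_le_of_le_one_right (hν.nonneg b hb) (abs_le.1 (hz b hb)).2
  have hsplit : ∑ y ∈ A, p y * estimationGap A ν η γ x q y z =
      ∑ y ∈ A, p y * ⟪y, z⟫ - (∑ y ∈ A, p y) * ⟪x, z⟫ -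
        (1 - γ) * (∑ y ∈ A, p y * ∑ b ∈ A, q b * ⟪b, e y⟫ - ∑ y ∈ A, p y * ⟪x, e y⟫ -
          η * ∑ y ∈ A, p y * ∑ b ∈ A, q b * ⟪b, e y⟫ ^ 2) := by
    rw [Finset.sum_mul, Finset.mul_sum (a := η), ← Finset.sum_sub_distrib,
      ← Finset.sum_sub_distrib, ← Finset.sum_sub_distrib, Finset.mul_sum (a := 1 - γ),
      ← Finset.sum_sub_distrib]
    refine Finset.sum_congr rfl fun y _ => ?_
    simp only [estimationGap, e, ← hp]
    ring
  rw [hsplit, hmix, hp1, hlinq, hlin]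
  have h1 := mul_le_mul_of_nonneg_left hquad hη
  have h2 := (abs_le.1 (hz x hx)).1
  have h3 := mul_le_mul_of_nonneg_left (sub_le_sub hνz h2) hγ0.le
  linarith

theorem abs_sum_mul_le_of_sum_eq_one {α : Type*} {A : Finset α} {q g : α → ℝ} {C : ℝ}
    (hq : ∀ x ∈ A, 0 ≤ q x) (hq1 : ∑ x ∈ A, q x = 1) (hg : ∀ x ∈ A, |g x| ≤ C) :
    |∑ x ∈ A, q x * g x| ≤ C := by
  refine (Finset.abs_sum_le_sum_abs _ _).trans ?_
  calc ∑ x ∈ A, |q x * g x| ≤ ∑ x ∈ A, q x * C := Finset.sum_le_sum fun x hx => by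
        rw [abs_mul, abs_of_nonneg (hq x hx)]
        exact mul_le_mul_of_nonneg_left (hg x hx) (hq x hx)
    _ = C := by rw [← Finset.sum_mul, hq1, one_mul]

/-- A crude bound that serves only integrability and conditioning; it does not enter the regret. -/
theorem abs_estimationGap_le [FiniteDimensional ℝ E] {A : Finset E} {ν q : E → ℝ}
    {η γ : ℝ} (hν : IsJohnExploration A ν) (hd : 0 < Module.finrank ℝ E)
    (hball : ∀ u ∈ A, ‖u‖ ≤ 1) (hη : 0 ≤ η)
    (hγ0 : 0 < γ) (hγ1 : γ ≤ 1) (hq : ∀ x ∈ A, 0 ≤ q x) (hq1 : ∑ x ∈ A, q x = 1)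
    {x y z : E} (hx : x ∈ A) (hy : y ∈ A) (hz : ∀ u ∈ A, |⟪u, z⟫| ≤ 1) :
    |estimationGap A ν η γ x q y z| ≤
      2 + (2 * (Module.finrank ℝ E / γ) + η * (Module.finrank ℝ E / γ) ^ 2) := by
  have he : ∀ b ∈ A, |⟪b, lossEstimate A (mixture γ ν q) y z⟫| ≤ Module.finrank ℝ E / γ :=
    fun b hb => abs_inner_lossEstimate_le hν hd hball hγ0 hγ1 hq hb hy (hz y hy)
  have he2 : ∀ b ∈ A, |⟪b, lossEstimate A (mixture γ ν q) y z⟫ ^ 2| ≤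
      (Module.finrank ℝ E / γ) ^ 2 := fun b hb => by
    rw [abs_pow]
    exact pow_le_pow_left₀ (abs_nonneg _) (he b hb) 2
  have h1 := abs_sum_mul_le_of_sum_eq_one hq hq1 he
  have h2 := mul_le_mul_of_nonneg_left (abs_sum_mul_le_of_sum_eq_one hq hq1 he2) hη
  rw [← abs_of_nonneg hη, ← abs_mul, abs_of_nonneg hη] at h2
  have h3 : ∀ r : ℝ, |(1 - γ) * r| ≤ |r| := fun r => by
    rw [abs_mul, abs_of_nonneg (sub_nonneg.2 hγ1)]
    exact mul_le_of_le_one_left (abs_nonneg _) (by linarith)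
  rw [estimationGap]
  refine (abs_sub _ _).trans (add_le_add ?_ ((h3 _).trans ?_))
  · exact (abs_sub _ _).trans (by linarith [hz x hx, hz y hy])
  · refine (abs_sub _ _).trans (add_le_add ((abs_sub _ _).trans ?_) h2)
    linarith [he x hx]

end Exp2

/-! ### Measurability, conditioning and the expected regret. -/

section Play

variable {E : Type*} [NormedAddCommGroup E] [InnerProductSpace ℝ E]

/-- The inverse is continuous on the open set of units and zero off it. -/
theorem measurable_ringInverse {R : Type*} [NormedRing R] [HasSummableGeomSeries R]
    [MeasurableSpace R] [BorelSpace R] : Measurable (Ring.inverse : R → R) := by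
  classical
  have h : (Ring.inverse : R → R) = {x | IsUnit x}.piecewise Ring.inverse 0 := by
    ext x
    by_cases hx : IsUnit x
    · exact (Set.piecewise_eq_of_mem {x : R | IsUnit x} _ _ hx).symm
    · exact (Ring.inverse_non_unit x hx).trans
        (Set.piecewise_eq_of_notMem {x : R | IsUnit x} Ring.inverse (0 : R → R) hx).symm
  rw [h]
  refine ContinuousOn.measurable_piecewise ?_ continuousOn_const Units.isOpen.measurableSet
  rintro _ ⟨u, rfl⟩
  exact (NormedRing.inverse_continuousAt u).continuousWithinAt

theorem measurable_mixture {E Ω : Type*} [MeasurableSpace Ω] {ν : E → ℝ} {γ : ℝ}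
    {q : Ω → E → ℝ} {x : E}
    (hq : Measurable fun ω => q ω x) : Measurable fun ω => mixture γ ν (q ω) x :=
  (hq.const_mul _).add_const _

theorem IsExp2Play.nonempty [MeasurableSpace E] {Ω : Type*} [MeasurableSpace Ω]
    {P : Measure Ω} [IsProbabilityMeasure P] {A : Finset E} {Z : Set E} {ν : E → ℝ} {η γ : ℝ} {n : ℕ}
    {a z : ℕ → Ω → E} (h : IsExp2Play P A Z ν η γ n a z) (hn : 0 < n) : A.Nonempty := by
  have : Nonempty Ω := nonempty_of_isProbabilityMeasure P
  exact ⟨_, h.action_mem 0 hn (Classical.arbitrary Ω)⟩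

variable [FiniteDimensional ℝ E] [MeasurableSpace E] [BorelSpace E]
variable {Ω : Type*}

theorem measurable_lossEstimate [MeasurableSpace Ω] {A : Finset E} {p : Ω → E → ℝ} {y z : Ω → E}
    (hp : ∀ u ∈ A, Measurable fun ω => p ω u) (hy : Measurable y) (hz : Measurable z) :
    Measurable fun ω => lossEstimate A (p ω) (y ω) (z ω) := by
  have hM : Measurable fun ω => secondMoment A (p ω) := by
    simp only [secondMoment]
    exact Finset.measurable_fun_sum A fun u hu => (hp u hu).smul_const _
  simp only [lossEstimate_eq]
  exact (hy.inner hz).smul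
    (ContinuousLinearMap.measurable_apply₂.comp ((measurable_ringInverse.comp hM).prodMk hy))

theorem measurable_expWeights [MeasurableSpace Ω] {A : Finset E} {ν : E → ℝ} {η γ : ℝ}
    {a z : ℕ → Ω → E} (t : ℕ) (ha : ∀ s < t, Measurable (a s)) (hz : ∀ s < t, Measurable (z s)) :
    ∀ x ∈ A, Measurable fun ω => expWeights A ν η γ (fun s => a s ω) (fun s => z s ω) t x := by
  induction t with
  | zero => exact fun x _ => measurable_const
  | succ t ih =>
    have iht := ih (fun s hs => ha s (by omega)) (fun s hs => hz s (by omega))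
    have hl := measurable_lossEstimate (fun u hu => measurable_mixture (γ := γ) (ν := ν) (iht u hu))
      (ha t (by omega)) (hz t (by omega))
    have hw : ∀ x ∈ A, Measurable fun ω =>
        Real.exp (-η * ⟪x, lossEstimate A (mixture γ ν
            (expWeights A ν η γ (fun s => a s ω) (fun s => z s ω) t)) (a t ω) (z t ω)⟫) *
          expWeights A ν η γ (fun s => a s ω) (fun s => z s ω) t x := fun x hx =>
      ((measurable_const.inner hl).const_mul _).exp.mul (iht x hx)
    exact fun x hx => (hw x hx).div (Finset.measurable_fun_sum A hw)

theorem measurable_estimationGap [MeasurableSpace Ω] {A : Finset E} {ν : E → ℝ} {η γ : ℝ} {x : E}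
    {q : Ω → E → ℝ} {y z : Ω → E} (hq : ∀ u ∈ A, Measurable fun ω => q ω u)
    (hy : Measurable y) (hz : Measurable z) :
    Measurable fun ω => estimationGap A ν η γ x (q ω) (y ω) (z ω) := by
  have hl := measurable_lossEstimate (fun u hu => measurable_mixture (γ := γ) (ν := ν) (hq u hu))
    hy hz
  have hb : ∀ b : E, Measurable fun ω => ⟪b, lossEstimate A (mixture γ ν (q ω)) (y ω) (z ω)⟫ :=
    fun b => measurable_const.inner hl
  have h1 := Finset.measurable_fun_sum A fun b hbA => (hq b hbA).mul (hb b)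
  have h2 := Finset.measurable_fun_sum A fun b hbA => (hq b hbA).mul ((hb b).pow_const 2)
  exact ((hy.inner hz).sub (measurable_const.inner hz)).sub
    (((h1.sub (hb x)).sub (h2.const_mul η)).const_mul (1 - γ))

/-- If `a` takes values in `A` and has conditional law `p` given `m`, the expectation of `F ω (a ω)`
is obtained by averaging over `p`, for bounded `F` that is `m`-measurable in the first argument. -/
theorem integral_apply_eq_of_condExp {m m0 : MeasurableSpace Ω} (hm : m ≤ m0) {P : Measure Ω}
    [IsProbabilityMeasure P] {A : Finset E} {a : Ω → E} (ha : Measurable a) (haA : ∀ ω, a ω ∈ A)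
    {p : E → Ω → ℝ}
    (hlaw : ∀ x ∈ A, P[(a ⁻¹' {x}).indicator (fun _ => (1 : ℝ)) | m] =ᵐ[P] p x)
    {F : Ω → E → ℝ} {C : ℝ} (hF : ∀ x ∈ A, Measurable[m] fun ω => F ω x)
    (hC : ∀ ω, ∀ x ∈ A, |F ω x| ≤ C) :
    ∫ ω, F ω (a ω) ∂P = ∫ ω, ∑ x ∈ A, p x ω * F ω x ∂P := by
  classical
  have hind : ∀ x, Integrable ((a ⁻¹' {x}).indicator fun _ => (1 : ℝ)) P := fun x =>
    (integrable_const 1).indicator (ha (measurableSet_singleton x))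
  have hbound : ∀ x ∈ A, ∀ᵐ ω ∂P, ‖F ω x‖ ≤ C := fun x hx =>
    Filter.Eventually.of_forall fun ω => hC ω x hx
  -- With the action fixed at `x`, the factor `F ω x` is known given `m` and leaves the conditional
  -- expectation.
  have hpull : ∀ x ∈ A,
      P[(fun ω => F ω x) * (a ⁻¹' {x}).indicator (fun _ => (1 : ℝ)) | m] =ᵐ[P]
        fun ω => p x ω * F ω x := by
    intro x hx
    filter_upwards [condExp_stronglyMeasurable_mul_of_bound hm (hF x hx).stronglyMeasurable
      (hind x) C (hbound x hx), hlaw x hx] with ω h1 h2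
    rw [h1, Pi.mul_apply, h2, mul_comm]
  have hint : ∀ x ∈ A, Integrable
      (fun ω => F ω x * (a ⁻¹' {x}).indicator (fun _ => (1 : ℝ)) ω) P := fun x hx =>
    (hind x).bdd_mul ((hF x hx).mono hm le_rfl).aestronglyMeasurable (hbound x hx)
  have hdecomp : ∀ ω, F ω (a ω) =
      ∑ x ∈ A, F ω x * (a ⁻¹' {x}).indicator (fun _ => (1 : ℝ)) ω := by
    intro ω
    rw [Finset.sum_eq_single_of_mem (a ω) (haA ω)]
    · simp
    · intro x _ hx
      simp [Set.indicator, hx.symm]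
  simp only [hdecomp]
  rw [integral_finsetSum _ hint, integral_finsetSum]
  · refine Finset.sum_congr rfl fun x hx => ?_
    rw [← integral_congr_ae (hpull x hx), integral_condExp hm]
    rfl
  · exact fun x hx => (integrable_condExp.congr (hpull x hx))

variable [MeasurableSpace Ω] {P : Measure Ω} [IsProbabilityMeasure P] {A : Finset E} {Z : Set E}
  {ν : E → ℝ} {η γ : ℝ} {n : ℕ} {a z : ℕ → Ω → E}

theorem IsExp2Play.integrable_action_loss (h : IsExp2Play P A Z ν η γ n a z)
    (hZ : ∀ x ∈ A, ∀ z ∈ Z, |⟪x, z⟫| ≤ 1) {t : ℕ} (ht : t < n) :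
    Integrable (fun ω => ⟪a t ω, z t ω⟫) P :=
  Integrable.of_bound
    ((h.measurable_action t ht).inner (h.measurable_loss t ht)).aestronglyMeasurable 1
    (Filter.Eventually.of_forall fun ω => hZ _ (h.action_mem t ht ω) _ (h.loss_mem t ht ω))

theorem IsExp2Play.integrable_loss (h : IsExp2Play P A Z ν η γ n a z)
    (hZ : ∀ x ∈ A, ∀ z ∈ Z, |⟪x, z⟫| ≤ 1) {x : E} (hx : x ∈ A) {t : ℕ} (ht : t < n) :
    Integrable (fun ω => ⟪x, z t ω⟫) P :=
  Integrable.of_bound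
    (measurable_const.inner (h.measurable_loss t ht)).aestronglyMeasurable 1
    (Filter.Eventually.of_forall fun ω => hZ _ hx _ (h.loss_mem t ht ω))

/-- The regret is at most `B` when the regret against each fixed action is. -/
theorem IsExp2Play.regret_le (h : IsExp2Play P A Z ν η γ n a z)
    (hZ : ∀ x ∈ A, ∀ z ∈ Z, |⟪x, z⟫| ≤ 1) (hn : 0 < n) {B : ℝ}
    (hB : ∀ x ∈ A, ∫ ω, ∑ t ∈ Finset.range n, (⟪a t ω, z t ω⟫ - ⟪x, z t ω⟫) ∂P ≤ B) :
    regret P A n a z ≤ B := by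
  have : Nonempty A := (h.nonempty hn).to_subtype
  rw [regret, sub_le_comm]
  refine le_ciInf fun x => ?_
  have hx := hB x x.2
  simp only [Finset.sum_sub_distrib] at hx
  rw [integral_sub] at hx
  · linarith
  · exact integrable_finsetSum _ fun t ht =>
      h.integrable_action_loss hZ (Finset.mem_range.1 ht)
  · exact integrable_finsetSum _ fun t ht =>
      h.integrable_loss hZ x.2 (Finset.mem_range.1 ht)

/-- Settles the case `γ > 1`, where coercivity of the second moment is not available. -/
theorem IsExp2Play.regret_le_two_mul (h : IsExp2Play P A Z ν η γ n a z)
    (hZ : ∀ x ∈ A, ∀ z ∈ Z, |⟪x, z⟫| ≤ 1) (hn : 0 < n) : regret P A n a z ≤ 2 * n := by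
  refine h.regret_le hZ hn fun x hx => ?_
  have hle : ∀ ω, ∑ t ∈ Finset.range n, (⟪a t ω, z t ω⟫ - ⟪x, z t ω⟫) ≤ 2 * n := by
    intro ω
    have : ∑ t ∈ Finset.range n, (⟪a t ω, z t ω⟫ - ⟪x, z t ω⟫) ≤ ∑ t ∈ Finset.range n, (2 : ℝ) := by
      refine Finset.sum_le_sum fun t ht => ?_
      have ht := Finset.mem_range.1 ht
      have h1 := abs_le.1 (hZ _ (h.action_mem t ht ω) _ (h.loss_mem t ht ω))
      have h2 := abs_le.1 (hZ _ hx _ (h.loss_mem t ht ω))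
      linarith [h1.2, h2.1]
    simpa [mul_comm] using this
  have := integral_mono (μ := P) (integrable_finsetSum (Finset.range n) fun t ht =>
      (h.integrable_action_loss hZ (Finset.mem_range.1 ht)).sub
        (h.integrable_loss hZ hx (Finset.mem_range.1 ht))) (integrable_const (2 * (n : ℝ))) hle
  simpa using this

/-- The expected regret of the exponential weights with exploration. -/
theorem IsExp2Play.regret_le_of_gamma_le_one (h : IsExp2Play P A Z ν η γ n a z)
    (hZ : ∀ x ∈ A, ∀ z ∈ Z, |⟪x, z⟫| ≤ 1) (hn : 0 < n) (hν : IsJohnExploration A ν)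
    (hd : 0 < Module.finrank ℝ E) (hball : ∀ u ∈ A, ‖u‖ ≤ 1) (hη : 0 < η) (hγ0 : 0 < γ)
    (hγ1 : γ ≤ 1) (hηγ : η * Module.finrank ℝ E / γ ≤ 1) :
    regret P A n a z ≤
      2 * γ * n + Real.log A.card / η + η * n * Module.finrank ℝ E := by
  have hne := h.nonempty hn
  refine h.regret_le hZ hn fun x hx => ?_
  let q : ℕ → Ω → E → ℝ := fun t ω => expWeights A ν η γ (fun s => a s ω) (fun s => z s ω) t
  have hq : ∀ t ω, (∀ x ∈ A, 0 < q t ω x) ∧ ∑ x ∈ A, q t ω x = 1 := fun t ω =>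
    expWeights_pos_and_sum hne ν η γ _ _ t
  have hq0 : ∀ t ω, ∀ x ∈ A, 0 ≤ q t ω x := fun t ω x hx => ((hq t ω).1 x hx).le
  have hzA : ∀ t < n, ∀ ω, ∀ u ∈ A, |⟪u, z t ω⟫| ≤ 1 := fun t ht ω u hu =>
    hZ u hu _ (h.loss_mem t ht ω)
  have hgap : ∀ t < n, ∀ ω, ∀ y ∈ A, |estimationGap A ν η γ x (q t ω) y (z t ω)| ≤
      2 + (2 * (Module.finrank ℝ E / γ) + η * (Module.finrank ℝ E / γ) ^ 2) :=
    fun t ht ω y hy => abs_estimationGap_le hν hd hball hη.le hγ0 hγ1 (hq0 t ω) (hq t ω).2 hx hy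
      (hzA t ht ω)
  have hgapint : ∀ t < n,
      Integrable (fun ω => estimationGap A ν η γ x (q t ω) (a t ω) (z t ω)) P := fun t ht =>
    Integrable.of_bound (measurable_estimationGap
      (measurable_expWeights t (fun s hs => h.measurable_action s (hs.trans ht))
        fun s hs => h.measurable_loss s (hs.trans ht))
      (h.measurable_action t ht) (h.measurable_loss t ht)).aestronglyMeasurable _
      (Filter.Eventually.of_forall fun ω => hgap t ht ω _ (h.action_mem t ht ω))
  have hround : ∀ t < n, ∫ ω, estimationGap A ν η γ x (q t ω) (a t ω) (z t ω) ∂P ≤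
      2 * γ + η * Module.finrank ℝ E := by
    intro t ht
    have hm : history a z t ≤ ‹MeasurableSpace Ω› :=
      sup_le (iSup₂_le fun s hs => (h.measurable_action s (hs.trans ht)).comap_le)
        (iSup₂_le fun s hs => (h.measurable_loss s (hs.trans_lt ht)).comap_le)
    have ha' : ∀ s < t, Measurable[history a z t] (a s) := fun s hs =>
      measurable_iff_comap_le.2 (le_sup_of_le_left (le_iSup₂_of_le s hs le_rfl))
    have hz' : ∀ s ≤ t, Measurable[history a z t] (z s) := fun s hs =>
      measurable_iff_comap_le.2 (le_sup_of_le_right (le_iSup₂_of_le s hs le_rfl))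
    -- The weights of round `t` involve only rounds `s < t`, so they are measurable for the history
    -- as well.
    have hq' := @measurable_expWeights E _ _ _ _ _ Ω (history a z t) A ν η γ a z t ha'
      fun s hs => hz' s hs.le
    have hF : ∀ y ∈ A, Measurable[history a z t]
        fun ω => estimationGap A ν η γ x (q t ω) y (z t ω) := fun y _ =>
      @measurable_estimationGap E _ _ _ _ _ Ω (history a z t) A ν η γ x (q t) (fun _ => y) (z t)
        hq' (@measurable_const _ _ _ (history a z t) y) (hz' t le_rfl)
    rw [integral_apply_eq_of_condExp (p := fun y ω => mixture γ ν (q t ω) y) hm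
      (h.measurable_action t ht) (h.action_mem t ht) (h.action_law t ht)
      (F := fun ω y => estimationGap A ν η γ x (q t ω) y (z t ω)) hF (hgap t ht)]
    have hle : ∀ ω, ∑ y ∈ A, mixture γ ν (q t ω) y *
        estimationGap A ν η γ x (q t ω) y (z t ω) ≤ 2 * γ + η * Module.finrank ℝ E := fun ω =>
      sum_mixture_mul_estimationGap_le hν hd hη.le hγ0 hγ1 (hq0 t ω) (hq t ω).2 hx (hzA t ht ω)
    have hnn : 0 ≤ 2 * γ + η * (Module.finrank ℝ E : ℝ) := by positivity
    -- Integrability need not be proved: otherwise the integral is `0` by convention, and the bound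
    -- is nonnegative.
    by_cases hint : Integrable (fun ω => ∑ y ∈ A, mixture γ ν (q t ω) y *
        estimationGap A ν η γ x (q t ω) y (z t ω)) P
    · simpa using integral_mono hint (integrable_const (μ := P) _) hle
    · rw [integral_undef hint]
      exact hnn
  have hlog : 0 ≤ Real.log A.card / η :=
    div_nonneg (Real.log_natCast_nonneg _) hη.le
  have hpath : ∀ ω, ∑ t ∈ Finset.range n, (⟪a t ω, z t ω⟫ - ⟪x, z t ω⟫) ≤
      ∑ t ∈ Finset.range n, estimationGap A ν η γ x (q t ω) (a t ω) (z t ω) +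
        Real.log A.card / η := by
    intro ω
    have hw := exp_weights_regret_le (A := A) hη (q := fun t => q t ω) (n := n)
      (l := fun t b => ⟪b, lossEstimate A (mixture γ ν (q t ω)) (a t ω) (z t ω)⟫)
      (fun t => (hq t ω).1) (fun t => (hq t ω).2) (fun _ _ => rfl) (fun _ _ _ _ => rfl)
      (fun t ht b hb => by
        refine le_trans (mul_le_mul_of_nonneg_left (abs_inner_lossEstimate_le hν hd hball hγ0 hγ1
          (hq0 t ω) hb (h.action_mem t ht ω) (hzA t ht ω _ (h.action_mem t ht ω))) hη.le) ?_
        rwa [← mul_div_assoc]) hx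
    have h1 := mul_le_mul_of_nonneg_left hw (sub_nonneg.2 hγ1)
    have h2 : (1 - γ) * (Real.log A.card / η) ≤ Real.log A.card / η :=
      mul_le_of_le_one_left hlog (by linarith)
    rw [Finset.mul_sum] at h1
    simp only [estimationGap, Finset.sum_sub_distrib (f := fun t => ⟪a t ω, z t ω⟫ - ⟪x, z t ω⟫)]
    linarith
  have hI1 : Integrable (fun ω => ∑ t ∈ Finset.range n, (⟪a t ω, z t ω⟫ - ⟪x, z t ω⟫)) P :=
    integrable_finsetSum _ fun t ht => (h.integrable_action_loss hZ (Finset.mem_range.1 ht)).sub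
        (h.integrable_loss hZ hx (Finset.mem_range.1 ht))
  have hI2 : Integrable (fun ω =>
      ∑ t ∈ Finset.range n, estimationGap A ν η γ x (q t ω) (a t ω) (z t ω)) P :=
    integrable_finsetSum _ fun t ht => hgapint t (Finset.mem_range.1 ht)
  refine (integral_mono hI1 (hI2.add (integrable_const _)) hpath).trans ?_
  have hadd := integral_add hI2 (integrable_const (μ := P) (Real.log A.card / η))
  rw [integral_finsetSum _ fun t ht => hgapint t (Finset.mem_range.1 ht)] at hadd
  have hsum := Finset.sum_le_sum fun t ht => hround t (Finset.mem_range.1 ht)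
  rw [Finset.sum_const, Finset.card_range, nsmul_eq_mul] at hsum
  rw [integral_const, probReal_univ, one_smul] at hadd
  refine hadd.le.trans ?_
  linarith

end Play

theorem theorem4 {E : Type*} [NormedAddCommGroup E] [InnerProductSpace ℝ E]
    [FiniteDimensional ℝ E] [MeasurableSpace E] [BorelSpace E]
    (d : ℕ) (hd : 0 < d) (hE : Module.finrank ℝ E = d)
    (A : Finset E) (N : ℕ) (hN : A.card = N)
    (hA : IsJohnEllipsoid (convexHull ℝ (A : Set E)) (Metric.closedBall (0 : E) 1)) :
    (∃ ν : E → ℝ, IsJohnExploration A ν ∧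
      {u | u ∈ A ∧ ν u ≠ 0}.ncard ≤ d * (d + 1) / 2 + 1) ∧
    ∀ ν : E → ℝ, IsJohnExploration A ν →
      ∀ Z : Set E, (∀ x ∈ A, ∀ z ∈ Z, |⟪x, z⟫| ≤ 1) →
      ∀ {Ω : Type*} [MeasurableSpace Ω] (P : Measure Ω) [IsProbabilityMeasure P]
        (η γ : ℝ) (n : ℕ) (a z : ℕ → Ω → E), 0 < n → IsExp2Play P A Z ν η γ n a z →
        (0 < η → 0 < γ → η * d / γ ≤ 1 →
          regret P A n a z ≤ 2 * γ * n + Real.log N / η + η * n * d) ∧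
        (γ = η * d → η = √(Real.log N / (3 * n * d)) →
          regret P A n a z ≤ 2 * √(3 * n * d * Real.log N)) := by

  have hd' : 0 < Module.finrank ℝ E := hE ▸ hd
  have : Nontrivial E := Module.finrank_pos_iff.1 hd'
  have hball : ∀ u ∈ A, ‖u‖ ≤ 1 := fun u hu => by
    simpa using hA.subset (subset_convexHull ℝ _ hu)
  refine ⟨hE ▸ hA.exists_isJohnExploration, ?_⟩
  intro ν hν Z hZ Ω _ P _ η γ n a z hn h
  have hn' : (0 : ℝ) < n := by exact_mod_cast hn
  have hdR : (0 : ℝ) < d := by exact_mod_cast hd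
  have hlog : 0 ≤ Real.log N := Real.log_natCast_nonneg N
  have htriv := h.regret_le_two_mul hZ hn
  have hfirst : 0 < η → 0 < γ → η * d / γ ≤ 1 →
      regret P A n a z ≤ 2 * γ * n + Real.log N / η + η * n * d := by
    intro hη hγ hηγ
    rcases le_or_gt γ 1 with hγ1 | hγ1
    · have := h.regret_le_of_gamma_le_one hZ hn hν hd' hball hη hγ hγ1 (by rwa [hE])
      rwa [hE, hN] at this
    · have h1 : 2 * (n : ℝ) ≤ 2 * γ * n := by nlinarith
      have h2 : 0 ≤ Real.log N / η := div_nonneg hlog hη.le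
      have h3 : 0 ≤ η * n * d := by positivity
      linarith
  refine ⟨hfirst, fun hγ hη => ?_⟩
  -- If `log N = 0` then `η = γ = 0` and the first bound does not apply, but there is only one
  -- action and no regret.
  rcases hlog.eq_or_lt with h0 | hpos
  · have hN1 : A.card ≤ 1 := by
      by_contra! hc
      have : 0 < Real.log N := Real.log_pos (by rw [← hN]; exact_mod_cast hc)
      linarith
    have hzero : regret P A n a z ≤ 0 := by
      refine h.regret_le hZ hn fun x hx => le_of_eq ?_
      rw [← integral_zero Ω ℝ (μ := P)]
      refine integral_congr_ae (Filter.Eventually.of_forall fun ω => ?_)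
      refine Finset.sum_eq_zero fun t ht => ?_
      rw [Finset.card_le_one.1 hN1 _ (h.action_mem t (Finset.mem_range.1 ht) ω) _ hx, sub_self]
    refine hzero.trans ?_
    positivity
  · have hηpos : 0 < η := by rw [hη]; positivity
    have hγpos : 0 < γ := by rw [hγ]; positivity
    have hr := hfirst hηpos hγpos (by rw [hγ, div_self (by positivity)])
    have hsq : η ^ 2 = Real.log N / (3 * n * d) := by rw [hη, Real.sq_sqrt (by positivity)]
    have hL : Real.log N = η ^ 2 * (3 * n * d) := by rw [hsq]; field_simp
    -- In units of `η n d` the three terms of the first bound are `2`, `3` and `1`; their sum `6` is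
    -- twice this root.
    have hroot : √(3 * n * d * Real.log N) = 3 * n * d * η := by
      rw [hL, show 3 * (n : ℝ) * d * (η ^ 2 * (3 * n * d)) = (3 * n * d * η) ^ 2 by ring,
        Real.sqrt_sq (by positivity)]
    have hdiv : Real.log N / η = 3 * n * d * η := by rw [hL]; field_simp
    rw [hroot]
    rw [hdiv, hγ] at hr
    linarith
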